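/- For a permutation $\pi=a_1a_2\cdots a_n$ of $\{1,\dots,n\}$, a position $i$ with $1\le i\le n-1$ is a descent if $a_i>a_{i+1}$. Let $\mathrm{des}(\pi)$, $\mathrm{odes}(\pi)$ and $\mathrm{edes}(\pi)$ be the number of descents of $\pi$, of descents in odd positions, and of descents in even positions, respectively. Let $$A_n(q)=\sum_{\pi\in\mathfrak S_n}q^{\mathrm{des}(\pi)},\qquad A_n(p,q)=\sum_{\pi\in\mathfrak S_n}p^{\mathrm{odes}(\pi)}q^{\mathrm{edes}(\pi)}$$ be the classical and the refined Eulerian polynomials. Let $C(u)=\frac{1-\sqrt{1-4u}}{2u}$, with $C(0)=1$, be the generating function $\sum_{k\ge0}\frac1{k+1}\binom{2k}{k}u^k$ of the Catalan numbers, and put $$y=\frac{p+q}{2(1+pq)},\qquad C=C(y^2)=C\!\left(\frac{(p+q)^2}{4(1+pq)^2}\right),\qquad x=y\,C(y^2).$$ Then for every integer $n\ge 0$ $$A_{2n+1}(p,q)=A_{2n+1}(x)\left(\frac{1+pq}{C}\right)^{n},\qquad A_{2n+2}(p,q)=\frac{1+x}{1+q}\,A_{2n+2}(x)\left(\frac{1+pq}{C}\right)^{n+1}.$$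 These identities hold 1. for all complex numbers $p,q$ with $1+pq\neq0$, and $1+q\ne0$ in the second identity, where $C(u)$ is the function given by the closed form above with the principal square root; 2. for indeterminates $p,q$, in the ring of formal power series $\mathbb{Q}[[p,q]]$, where $C(u)$ is the power series above. -/

import Mathlib

/-- Index `i` of `Fin n` stands for position `i + 1` of the word `a₁ a₂ … aₙ` of `π`
(so `a_{i+1} = π i`).
The position is a descent if it is not the last one and `a_{i+1} > a_{i+2}`. -/
def IsDescent {n : ℕ} (π : Equiv.Perm (Fin n)) (i : Fin n) : Prop :=
  ∃ h : (i : ℕ) + 1 < n, π ⟨(i : ℕ) + 1, h⟩ < π i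

instance {n : ℕ} (π : Equiv.Perm (Fin n)) : DecidablePred (IsDescent π) := fun i => by
  unfold IsDescent; infer_instance

/-- The number of descents of `π`. -/
def des {n : ℕ} (π : Equiv.Perm (Fin n)) : ℕ :=
  (Finset.univ.filter fun i : Fin n => IsDescent π i).card

/-- The number of descents of `π` in odd positions (positions are counted from 1). -/
def odes {n : ℕ} (π : Equiv.Perm (Fin n)) : ℕ :=
  (Finset.univ.filter fun i : Fin n => IsDescent π i ∧ Odd ((i : ℕ) + 1)).card

/-- The number of descents of `π` in even positions (positions are counted from 1). -/
def edes {n : ℕ} (π : Equiv.Perm (Fin n)) : ℕ :=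
  (Finset.univ.filter fun i : Fin n => IsDescent π i ∧ Even ((i : ℕ) + 1)).card

/-- The classical Eulerian polynomial `A_n`, evaluated at an element of a commutative semiring. -/
def eulerian {R : Type*} [CommSemiring R] (n : ℕ) (q : R) : R :=
  ∑ π : Equiv.Perm (Fin n), q ^ des π

/-- The refined Eulerian polynomial `A_n(p, q)`, evaluated at two elements of a commutative
semiring. -/
def refinedEulerian {R : Type*} [CommSemiring R] (n : ℕ) (p q : R) : R :=
  ∑ π : Equiv.Perm (Fin n), p ^ odes π * q ^ edes π

open Classical in
/-- The function `C(u) = (1 - √(1 - 4u)) / (2u)` on the complex numbers, with the principal square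
root; at the removable singularity `u = 0` its value is `C(0) = 1`. -/
noncomputable def catalanC (u : ℂ) : ℂ :=
  if u = 0 then 1 else (1 - (1 - 4 * u) ^ (1 / 2 : ℂ)) / (2 * u)

/-- The generating function `∑ Cₙ uⁿ` of the Catalan numbers, for a formal power series `u` in two
variables over `ℚ` (meaningful if `u` has constant term zero). -/
noncomputable def formalCatalanC (u : MvPowerSeries (Fin 2) ℚ) : MvPowerSeries (Fin 2) ℚ :=
  (PowerSeries.catalanSeries.map (Nat.castRingHom ℚ)).subst u

/-! Splitting a permutation at its largest letter gives a quadratic recurrence for $A_n(p,q)$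
(`refinedEulerian_succ`). By induction on it, $A_{2m+1}(p,q)$ and $A_{2m+2}(p,q)/(1+p)$ behave like
forms of degree $m$ in $p+q$ and $1+pq$ (`isFormOfDegree_refinedEulerian`); symmetry of the odd case
comes from reversing and complementing words.

Up to the factor $(1+pq)^m$, such a form depends only on the ratio $(p+q)/(1+pq)=2y$. The pair
$(x,x)$ has the same ratio when $2x/(1+x^2)=2y$, and there the refined polynomial is the classical
one (`refinedEulerian_mul_pow`). The Catalan equation $C=1+y^2C^2$ says exactly that $x=yC$
satisfies $1+x^2=C$, hence solves this equation. -/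

/-- The weighted number of arrangements of a finite set `S` of size `n`, written after the
element `a`: if the `i`-th entry (counted from `0`) is smaller than the one before it, this
contributes the factor `w i`. -/
def arrangeSumAux {α R : Type*} [LinearOrder α] [CommSemiring R] :
    ℕ → Finset α → (ℕ → R) → α → R
  | 0, _, _, _ => 1
  | n + 1, S, w, a =>
    ∑ b ∈ S, (if b < a then w 0 else 1) * arrangeSumAux n (S.erase b) (fun i => w (i + 1)) b

/-- The weighted number of arrangements of a finite set `S`, written after the element `a`. -/
def arrangeSum {α R : Type*} [LinearOrder α] [CommSemiring R]
    (S : Finset α) (w : ℕ → R) (a : α) : R :=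
  arrangeSumAux S.card S w a

/-! ### Words weighted by descents, and splitting at the largest letter. -/

section arrange

variable {α R : Type*} [LinearOrder α] [CommSemiring R]

@[simp] lemma arrangeSum_empty (w : ℕ → R) (a : α) : arrangeSum ∅ w a = 1 := rfl

lemma arrangeSum_eq_sum {S : Finset α} (hS : S.Nonempty) (w : ℕ → R) (a : α) :
    arrangeSum S w a =
      ∑ b ∈ S, (if b < a then w 0 else 1) * arrangeSum (S.erase b) (fun i => w (i + 1)) b := by
  obtain ⟨n, hn⟩ := Nat.exists_eq_succ_of_ne_zero hS.card_pos.ne'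
  rw [arrangeSum, hn, Nat.succ_eq_add_one, arrangeSumAux]
  refine Finset.sum_congr rfl fun b hb => ?_
  rw [arrangeSum, Finset.card_erase_of_mem hb, hn]
  rfl

/-- Arrangement sums only depend on the order type of the set and its cut by `a`. -/
lemma arrangeSum_image {β : Type*} [LinearOrder β] {f : α → β} (hf : StrictMono f) :
    ∀ (S : Finset α) (w : ℕ → R) (a : α) (b : β), (∀ s ∈ S, f s < b ↔ s < a) →
      arrangeSum (S.image f) w b = arrangeSum S w a := by
  intro S
  induction S using Finset.strongInduction with
  | H S ih =>
    intro w a b h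
    rcases S.eq_empty_or_nonempty with rfl | hS
    · simp
    rw [arrangeSum_eq_sum hS, arrangeSum_eq_sum (hS.image f),
      Finset.sum_image hf.injective.injOn]
    refine Finset.sum_congr rfl fun s hs => ?_
    rw [← Finset.image_erase hf.injective,
      ih _ (Finset.erase_ssubset hs) _ s _ fun t _ => hf.lt_iff_lt]
    simp only [h s hs]

/-- Splitting an arrangement at its largest element. -/
lemma arrangeSum_insert_max (m : α) :
    ∀ (S : Finset α) (w : ℕ → R) (a : α), (∀ s ∈ S, s < m) → a ≤ m →
      arrangeSum (insert m S) w a =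
        ∑ T ∈ S.powerset, arrangeSum T w a *
          arrangeSum (S \ T) (fun i => w (i + T.card + 1)) m := by
  intro S
  induction S using Finset.strongInduction with
  | H S ih =>
    intro w a hS ha
    have hm : m ∉ S := fun h => (hS m h).false
    rw [arrangeSum_eq_sum (Finset.insert_nonempty _ _), Finset.sum_insert hm,
      if_neg ha.not_gt, Finset.erase_insert hm, one_mul,
      ← Finset.add_sum_erase _ _ (Finset.empty_mem_powerset S)]
    simp only [arrangeSum_empty, one_mul, Finset.sdiff_empty, Finset.card_empty, add_zero]
    congr 1
    have h1 : ∀ b ∈ S, (if b < a then w 0 else 1) *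
        arrangeSum ((insert m S).erase b) (fun i => w (i + 1)) b =
        ∑ T ∈ (S.erase b).powerset, (if b < a then w 0 else 1) *
          (arrangeSum T (fun i => w (i + 1)) b *
            arrangeSum (S.erase b \ T) (fun i => w (i + T.card + 1 + 1)) m) := by
      intro b hb
      rw [Finset.erase_insert_of_ne (hS b hb).ne',
        ih _ (Finset.erase_ssubset hb) _ _ (fun s hs => hS s (Finset.mem_of_mem_erase hs))
          (hS b hb).le, Finset.mul_sum]
    have h2 : ∀ T ∈ S.powerset.erase ∅, arrangeSum T w a *
        arrangeSum (S \ T) (fun i => w (i + T.card + 1)) m =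
        ∑ b ∈ T, (if b < a then w 0 else 1) * (arrangeSum (T.erase b) (fun i => w (i + 1)) b *
          arrangeSum (S \ T) (fun i => w (i + T.card + 1)) m) := by
      intro T hT
      rw [arrangeSum_eq_sum (Finset.nonempty_iff_ne_empty.2 (Finset.ne_of_mem_erase hT)),
        Finset.sum_mul]
      exact Finset.sum_congr rfl fun b _ => mul_assoc _ _ _
    rw [Finset.sum_congr rfl h1, Finset.sum_congr rfl h2, Finset.sum_sigma', Finset.sum_sigma']
    -- With `m` not in front, the block before `m` is nonempty: (first letter, rest of the block)
    -- corresponds to (block, first letter).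
    refine Finset.sum_bij' (fun x _ => ⟨insert x.1 x.2, x.1⟩) (fun y _ => ⟨y.2, y.1.erase y.2⟩)
      ?_ ?_ ?_ ?_ ?_
    · rintro ⟨b, T⟩ h
      simp only [Finset.mem_sigma, Finset.mem_powerset, Finset.mem_erase] at h ⊢
      exact ⟨⟨Finset.insert_ne_empty _ _,
        Finset.insert_subset h.1 (h.2.trans (Finset.erase_subset _ _))⟩,
        Finset.mem_insert_self _ _⟩
    · rintro ⟨T, b⟩ h
      simp only [Finset.mem_sigma, Finset.mem_powerset, Finset.mem_erase] at h ⊢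
      exact ⟨h.1.2 h.2, Finset.erase_subset_erase _ h.1.2⟩
    · rintro ⟨b, T⟩ h
      simp only [Finset.mem_sigma, Finset.mem_powerset] at h
      have : b ∉ T := fun hb => by simpa using h.2 hb
      simp [Finset.erase_insert this]
    · rintro ⟨T, b⟩ h
      simp only [Finset.mem_sigma] at h
      simp [Finset.insert_erase h.2]
    · rintro ⟨b, T⟩ h
      simp only [Finset.mem_sigma, Finset.mem_powerset] at h
      have hb : b ∉ T := fun hb => by simpa using h.2 hb
      have h3 : S.erase b \ T = S \ insert b T := by
        ext c
        simp only [Finset.mem_sdiff, Finset.mem_erase, Finset.mem_insert]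
        tauto
      simp only [Finset.erase_insert hb, Finset.card_insert_of_notMem hb, h3, add_assoc]

lemma image_val_univ_fin (n : ℕ) :
    (Finset.univ : Finset (Fin n)).image Fin.val = Finset.range n := by
  ext i
  simp only [Finset.mem_image, Finset.mem_univ, true_and, Finset.mem_range]
  exact ⟨fun ⟨j, hj⟩ => hj ▸ j.2, fun hi => ⟨⟨i, hi⟩, rfl⟩⟩

/-- The weighted number of words that are permutations of `n` letters, where a descent in
position `i` (counted from `1`) has weight `w i`. -/
def descentSum (n : ℕ) (w : ℕ → R) : R := arrangeSum (Finset.range n) w 0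

/-- No natural number lies below the initial `0`, so the first letter is never a descent, `w 0` is
not used, and only the size of the set matters. -/
lemma arrangeSum_eq_descentSum (S : Finset ℕ) (w : ℕ → R) :
    arrangeSum S w 0 = descentSum S.card w := by
  have h : (Finset.univ : Finset (Fin S.card)).image (S.orderEmbOfFin rfl) = S := by
    rw [← Finset.coe_inj, Finset.coe_image, Finset.coe_univ, Set.image_univ,
      Finset.range_orderEmbOfFin]
  have h' : (Finset.univ : Finset (Fin S.card)).image Fin.val = Finset.range S.card :=
    image_val_univ_fin _
  rcases S.eq_empty_or_nonempty with rfl | hS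
  · simp [descentSum]
  have : NeZero S.card := ⟨hS.card_pos.ne'⟩
  conv_lhs => rw [← h]
  rw [descentSum, ← h', arrangeSum_image (S.orderEmbOfFin rfl).strictMono _ _ 0 _ (by simp),
    arrangeSum_image Fin.val_strictMono _ _ 0 _ (by simp)]

@[simp] lemma descentSum_zero (w : ℕ → R) : descentSum 0 w = 1 := rfl

/-- If the element in front exceeds all others, the first letter contributes its weight. -/
lemma arrangeSum_of_lt {S : Finset ℕ} (hS : S.Nonempty) (w : ℕ → R) {m : ℕ}
    (hm : ∀ s ∈ S, s < m) : arrangeSum S w m = w 0 * descentSum S.card w := by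
  rw [← arrangeSum_eq_descentSum, arrangeSum_eq_sum hS, arrangeSum_eq_sum hS, Finset.mul_sum]
  refine Finset.sum_congr rfl fun b hb => ?_
  simp [hm b hb]

/-- The recurrence obtained by splitting a permutation at its largest letter. -/
lemma descentSum_succ (n : ℕ) (w : ℕ → R) :
    descentSum (n + 1) w = ∑ j ∈ Finset.range n, (n.choose j : R) *
      (descentSum j w * (w (j + 1) * descentSum (n - j) fun i => w (i + j + 1))) +
      descentSum n w := by
  rw [descentSum, Finset.range_add_one,
    arrangeSum_insert_max n _ _ _ (fun s hs => Finset.mem_range.1 hs) (Nat.zero_le n)]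
  -- The largest letter forms a descent with its successor unless it comes last, which is the case
  -- `j = n`.
  have h : ∀ T ∈ (Finset.range n).powerset,
      arrangeSum T w 0 * arrangeSum (Finset.range n \ T) (fun i => w (i + T.card + 1)) n =
      (fun j => descentSum j w * if j = n then 1 else
        w (j + 1) * descentSum (n - j) fun i => w (i + j + 1)) T.card := by
    intro T hT
    have hT := Finset.mem_powerset.1 hT
    have hc := Finset.card_sdiff_of_subset hT
    have hle := Finset.card_le_card hT
    rw [Finset.card_range] at hc hle
    rw [arrangeSum_eq_descentSum]
    dsimp only
    congr 1
    split_ifs with h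
    · rw [Finset.card_eq_zero.1 (hc.trans (by omega)), arrangeSum_empty]
    · rw [arrangeSum_of_lt (Finset.card_pos.1 (by omega)), hc, zero_add]
      intro s hs
      exact Finset.mem_range.1 (Finset.mem_sdiff.1 hs).1
  rw [Finset.sum_congr rfl h]
  refine (Finset.sum_powerset_apply_card (fun j => descentSum j w * if j = n then 1 else
    w (j + 1) * descentSum (n - j) fun i => w (i + j + 1))).trans ?_
  rw [Finset.card_range, Finset.sum_range_succ]
  simp only [nsmul_eq_mul, Nat.choose_self, Nat.cast_one, if_true, mul_one, one_mul]
  congr 1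
  refine Finset.sum_congr rfl fun j hj => ?_
  rw [if_neg (Finset.mem_range.1 hj).ne]

/-- Arrangement sums as sums over functions onto the set. -/
lemma arrangeSum_eq_sum_fun [Fintype α] :
    ∀ (n : ℕ) (S : Finset α) (w : ℕ → R) (a : α), S.card = n →
      arrangeSum S w a = ∑ f : Fin n → α, if Finset.univ.image f = S then
        ∏ i : Fin n, if f i < (Fin.cons a f : Fin (n + 1) → α) i.castSucc then w i else 1
        else 0 := by
  intro n
  induction n with
  | zero =>
    intro S w a h
    obtain rfl := Finset.card_eq_zero.1 h
    simp
  | succ n ih =>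
    intro S w a h
    rw [arrangeSum_eq_sum (Finset.card_pos.1 (by omega)),
      ← (Fin.consEquiv fun _ => α).sum_comp, Fintype.sum_prod_type,
      ← Finset.sum_subset (Finset.subset_univ S)]
    · refine Finset.sum_congr rfl fun b hb => ?_
      rw [ih _ _ b (by rw [Finset.card_erase_of_mem hb, h]; rfl), Finset.mul_sum]
      refine Finset.sum_congr rfl fun f _ => ?_
      have himg : (Finset.univ.image (Fin.consEquiv (fun _ => α) (b, f))) =
          insert b (Finset.univ.image f) := by
        ext c
        simp [Fin.consEquiv, Fin.exists_fin_succ, eq_comm]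
      have hiff : insert b (Finset.univ.image f) = S ↔ Finset.univ.image f = S.erase b := by
        constructor
        · intro he
          have hle : (Finset.univ.image f).card ≤ n := by
            simpa using Finset.card_image_le (s := Finset.univ) (f := f)
          have hb' : b ∉ Finset.univ.image f := by
            intro hb'
            rw [Finset.insert_eq_of_mem hb'] at he
            rw [he] at hle
            omega
          rw [← he, Finset.erase_insert hb']
        · intro he
          rw [he, Finset.insert_erase hb]
      rw [himg]
      simp only [hiff]
      by_cases hf : Finset.univ.image f = S.erase b
      · rw [if_pos hf, if_pos hf, Fin.prod_univ_succ]
        simp [Fin.consEquiv, Fin.castSucc_succ]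
      · rw [if_neg hf, if_neg hf, mul_zero]
    · intro b _ hb
      refine Finset.sum_eq_zero fun f _ => if_neg fun he => hb ?_
      rw [← he]
      exact Finset.mem_image.2 ⟨0, Finset.mem_univ _, by simp [Fin.consEquiv]⟩

end arrange

/-! ### Refined Eulerian polynomials: weights, symmetry, recurrence. -/

section perm

variable {R : Type*} [CommSemiring R]

lemma pow_odes_mul_pow_edes {n : ℕ} (π : Equiv.Perm (Fin n)) (p q : R) :
    p ^ odes π * q ^ edes π =
      ∏ i : Fin n, if IsDescent π i then (if Odd ((i : ℕ) + 1) then p else q) else 1 := by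
  rw [odes, edes, ← Finset.prod_const, ← Finset.prod_const, Finset.prod_filter,
    Finset.prod_filter, ← Finset.prod_mul_distrib]
  refine Finset.prod_congr rfl fun i _ => ?_
  simp only [← Nat.not_odd_iff_even]
  by_cases h : IsDescent π i <;> by_cases h' : Odd ((i : ℕ) + 1) <;> simp [h, h']

lemma refinedEulerian_eq_descentSum (n : ℕ) (p q : R) :
    refinedEulerian n p q = descentSum n fun i => if Odd i then p else q := by
  rcases n with _ | n
  · simp [refinedEulerian, odes, edes]
  have h' : (Finset.univ : Finset (Fin (n + 1))).image Fin.val = Finset.range (n + 1) :=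
    image_val_univ_fin _
  rw [descentSum, ← h', arrangeSum_image Fin.val_strictMono _ _ 0 _ (by simp),
    arrangeSum_eq_sum_fun (n + 1) _ _ _ (by simp), ← Finset.sum_filter, refinedEulerian]
  refine Finset.sum_bij (fun π _ => ⇑π) ?_ ?_ ?_ ?_
  · intro π _
    simp [Finset.image_univ_of_surjective π.surjective]
  · intro π _ σ _ h
    exact DFunLike.coe_injective h
  · intro f hf
    have hs : Function.Surjective f := fun b => by
      have hb := Finset.mem_univ b
      rw [← (Finset.mem_filter.1 hf).2] at hb
      obtain ⟨c, _, hc⟩ := Finset.mem_image.1 hb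
      exact ⟨c, hc⟩
    exact ⟨Equiv.ofBijective f (Finite.injective_iff_bijective.1
      (Finite.injective_iff_surjective.2 hs)), Finset.mem_univ _, rfl⟩
  · intro π _
    -- The last position on the left and the first letter on the right contribute `1`; what remains
    -- on both sides is the `n` adjacent pairs.
    rw [pow_odes_mul_pow_edes, Fin.prod_univ_castSucc, Fin.prod_univ_succ, mul_comm]
    have hlast : ¬ IsDescent π (Fin.last n) := fun ⟨h, _⟩ => by simp at h
    rw [if_neg hlast]
    congr 1
    refine Finset.prod_congr rfl fun i _ => ?_
    have hd : IsDescent π i.castSucc ↔ π i.succ < π i.castSucc :=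
      ⟨fun ⟨_, h⟩ => h, fun h => ⟨by simp, h⟩⟩
    simp [hd, Fin.castSucc_succ]

lemma eulerian_eq_refinedEulerian (n : ℕ) (q : R) : eulerian n q = refinedEulerian n q q := by
  refine Finset.sum_congr rfl fun π _ => ?_
  rw [pow_odes_mul_pow_edes, des, ← Finset.prod_const, Finset.prod_filter]
  simp

/-- Reversing and complementing a word of odd length exchanges the two kinds of descents. -/
lemma refinedEulerian_comm_of_odd {n : ℕ} (hn : Odd n) (p q : R) :
    refinedEulerian n p q = refinedEulerian n q p := by
  -- Counted from 1, a descent in position $k$ moves to position $n-k$, of opposite parity since $n$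
  -- is odd.
  have hd : ∀ (π : Equiv.Perm (Fin n)) (i j : Fin n), (i : ℕ) + j + 2 = n →
      IsDescent π j → IsDescent (Fin.revPerm * π * Fin.revPerm) i := by
    rintro π i j hij ⟨h, hlt⟩
    refine ⟨by omega, ?_⟩
    have h1 : Fin.rev i = ⟨j + 1, h⟩ := Fin.ext (by simp [Fin.val_rev]; omega)
    have h2 : Fin.rev ⟨i + 1, by omega⟩ = j := Fin.ext (by simp [Fin.val_rev]; omega)
    simpa [Equiv.Perm.mul_apply, h1, h2] using hlt
  have hinv : ∀ π : Equiv.Perm (Fin n),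
      Fin.revPerm * (Fin.revPerm * π * Fin.revPerm) * Fin.revPerm = π := by
    intro π
    ext i
    simp [Equiv.Perm.mul_apply]
  have hprod : ∀ π : Equiv.Perm (Fin n), p ^ odes π * q ^ edes π =
      q ^ odes (Fin.revPerm * π * Fin.revPerm) * p ^ edes (Fin.revPerm * π * Fin.revPerm) := by
    intro π
    rw [pow_odes_mul_pow_edes, pow_odes_mul_pow_edes]
    rw [← Finset.prod_filter, ← Finset.prod_filter]
    have hlt : ∀ (σ : Equiv.Perm (Fin n)) (i : Fin n), IsDescent σ i → (i : ℕ) + 1 < n :=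
      fun σ i ⟨h, _⟩ => h
    refine Finset.prod_bij' (fun i hi => ⟨n - 2 - i, by omega⟩) (fun i hi => ⟨n - 2 - i, by omega⟩)
      ?_ ?_ ?_ ?_ ?_
    · intro i hi
      have hi := (Finset.mem_filter.1 hi).2
      have := hlt _ _ hi
      exact Finset.mem_filter.2 ⟨Finset.mem_univ _, hd π _ i (by dsimp only; omega) hi⟩
    · intro i hi
      have hi := (Finset.mem_filter.1 hi).2
      have := hlt _ _ hi
      refine Finset.mem_filter.2 ⟨Finset.mem_univ _, ?_⟩
      rw [← hinv π]
      exact hd _ _ i (by dsimp only; omega) hi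
    · intro i hi
      have := hlt _ _ (Finset.mem_filter.1 hi).2
      exact Fin.ext (by dsimp only; omega)
    · intro i hi
      have := hlt _ _ (Finset.mem_filter.1 hi).2
      exact Fin.ext (by dsimp only; omega)
    · intro i hi
      have := hlt _ _ (Finset.mem_filter.1 hi).2
      have hpar : Odd (n - 2 - (i : ℕ) + 1) ↔ ¬ Odd ((i : ℕ) + 1) := by
        rw [Nat.odd_iff] at hn
        rw [Nat.odd_iff, Nat.odd_iff]
        omega
      simp only [hpar]
      split_ifs <;> simp_all
  refine Finset.sum_bij' (fun π _ => Fin.revPerm * π * Fin.revPerm)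
    (fun π _ => Fin.revPerm * π * Fin.revPerm) ?_ ?_ ?_ ?_ ?_
  · simp
  · simp
  · intro π _
    exact hinv π
  · intro π _
    exact hinv π
  · intro π _
    exact hprod π

/-- The recurrence obtained by splitting a permutation at its largest letter. -/
lemma refinedEulerian_succ (n : ℕ) (p q : R) :
    refinedEulerian (n + 1) p q = ∑ j ∈ Finset.range n, (n.choose j : R) *
      (if Even j then p * (refinedEulerian j p q * refinedEulerian (n - j) q p)
        else q * (refinedEulerian j p q * refinedEulerian (n - j) p q)) +
      refinedEulerian n p q := by
  simp only [refinedEulerian_eq_descentSum]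
  rw [descentSum_succ]
  congr 1
  refine Finset.sum_congr rfl fun j _ => ?_
  congr 1
  by_cases hj : Even j
  -- The word after the largest letter is shifted by $j+1$ positions, so for even $j$ the roles of
  -- `p` and `q` are exchanged in it.
  · have h : ∀ i, (Odd (i + j + 1)) ↔ ¬ Odd i := fun i => by
      rw [Nat.odd_iff, Nat.odd_iff]; rw [Nat.even_iff] at hj; omega
    simp only [h, if_pos hj, if_pos hj.add_one, ite_not]
    ring
  · have h : ∀ i, (Odd (i + j + 1)) ↔ Odd i := fun i => by
      rw [Nat.odd_iff, Nat.odd_iff]; rw [Nat.even_iff] at hj; omega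
    have h' : ¬ Odd (j + 1) := fun h => hj <| by
      rw [Nat.odd_iff] at h; rw [Nat.even_iff]; omega
    simp only [h, if_neg hj, if_neg h']
    ring

end perm

/-! ### Forms in $p+q$ and $1+pq$. -/

section homogeneous

variable {R : Type*} [CommRing R]

/-- A symmetric function of `p` and `q` that behaves like a form of degree `m` in
`p + q` and `1 + p * q`. -/
structure IsFormOfDegree (m : ℕ) (f : R → R → R) : Prop where
  symm : ∀ p q, f p q = f q p
  -- Division-free version of: $f(p,q)/(1+pq)^m$ depends only on $(p+q)/(1+pq)$.
  scale : ∀ p q p' q', (p + q) * (1 + p' * q') = (p' + q') * (1 + p * q) →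
    f p q * (1 + p' * q') ^ m = f p' q' * (1 + p * q) ^ m

namespace IsFormOfDegree

lemma natCast (c : ℕ) : IsFormOfDegree 0 fun _ _ : R => (c : R) :=
  ⟨fun _ _ => rfl, fun _ _ _ _ _ => by simp⟩

lemma add_self : IsFormOfDegree 1 fun p q : R => p + q :=
  ⟨add_comm, fun p q p' q' h => by simpa using h⟩

lemma one_add_mul_self : IsFormOfDegree 1 fun p q : R => 1 + p * q :=
  ⟨fun p q => by ring, fun p q p' q' _ => by ring⟩

lemma add {m : ℕ} {f g : R → R → R} (hf : IsFormOfDegree m f) (hg : IsFormOfDegree m g) :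
    IsFormOfDegree m fun p q => f p q + g p q :=
  ⟨fun p q => by simp only [hf.symm p q, hg.symm p q], fun p q p' q' h => by
    simp only [add_mul, hf.scale p q p' q' h, hg.scale p q p' q' h]⟩

lemma mul {m k d : ℕ} {f g : R → R → R} (hf : IsFormOfDegree m f) (hg : IsFormOfDegree k g)
    (hd : m + k = d) : IsFormOfDegree d fun p q => f p q * g p q :=
  ⟨fun p q => by simp only [hf.symm p q, hg.symm p q], fun p q p' q' h => by
    subst hd
    rw [pow_add, pow_add, mul_mul_mul_comm, hf.scale p q p' q' h, hg.scale p q p' q' h,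
      mul_mul_mul_comm]⟩

lemma sum {ι : Type*} {s : Finset ι} {m : ℕ} {f : ι → R → R → R}
    (hf : ∀ i ∈ s, IsFormOfDegree m (f i)) : IsFormOfDegree m fun p q => ∑ i ∈ s, f i p q :=
  ⟨fun p q => Finset.sum_congr rfl fun i hi => (hf i hi).symm p q, fun p q p' q' h => by
    rw [Finset.sum_mul, Finset.sum_mul]
    exact Finset.sum_congr rfl fun i hi => (hf i hi).scale p q p' q' h⟩

lemma of_two_mul [NoZeroDivisors R] (h2 : (2 : R) ≠ 0) {m : ℕ} {f : R → R → R}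
    (hf : IsFormOfDegree m fun p q => 2 * f p q) : IsFormOfDegree m f :=
  ⟨fun p q => mul_left_cancel₀ h2 (hf.symm p q), fun p q p' q' h =>
    mul_left_cancel₀ h2 (by simpa only [mul_assoc] using hf.scale p q p' q' h)⟩

end IsFormOfDegree

/-- The recurrence depends on the parity of $j$; $j=0$ stands apart because $A_0=1$ lacks the factor
$1+p$. -/
lemma Finset.sum_range_two_mul_add_one {M : Type*} [AddCommMonoid M] (f : ℕ → M) (m : ℕ) :
    ∑ j ∈ Finset.range (2 * m + 1), f j = f 0 + ∑ k ∈ Finset.range m, f (2 * k + 2) +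
      ∑ k ∈ Finset.range m, f (2 * k + 1) := by
  induction m with
  | zero => simp
  | succ m ih =>
    rw [show 2 * (m + 1) + 1 = 2 * m + 1 + 1 + 1 by ring, Finset.sum_range_succ,
      Finset.sum_range_succ, ih, Finset.sum_range_succ, Finset.sum_range_succ]
    abel

/-- Refined Eulerian polynomials of odd index are forms in `p + q` and `1 + p * q`, given the same
for smaller indices. -/
lemma isFormOfDegree_refinedEulerian_odd_step [NoZeroDivisors R] (h2 : (2 : R) ≠ 0) {m : ℕ}
    {G : ℕ → R → R → R}
    (hO : ∀ k < m + 1, IsFormOfDegree k (refinedEulerian (R := R) (2 * k + 1)))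
    (hG : ∀ k < m + 1, IsFormOfDegree k (G k))
    (hE : ∀ k < m + 1, ∀ p q, refinedEulerian (2 * k + 2) p q = (1 + p) * G k p q) :
    IsFormOfDegree (m + 1) (refinedEulerian (R := R) (2 * (m + 1) + 1)) := by
  -- The extreme terms give $(1+p)+p(1+q)=1+pq+2p$; for even $j>0$ the two factors give
  -- $(1+p)(1+q)=1+pq+(p+q)$.
  have key : ∀ p q : R, refinedEulerian (2 * (m + 1) + 1) p q =
      (1 + p * q + 2 * p) * G m p q +
      ∑ k ∈ Finset.range m, ((2 * m + 2).choose (2 * k + 2) : R) *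
        (p * ((1 + p * q + (p + q)) * (G k p q * G (m - 1 - k) p q))) +
      ∑ k ∈ Finset.range (m + 1), ((2 * m + 2).choose (2 * k + 1) : R) *
        (q * (refinedEulerian (2 * k + 1) p q * refinedEulerian (2 * (m - k) + 1) p q)) := by
    intro p q
    rw [show 2 * (m + 1) + 1 = 2 * m + 2 + 1 by ring, refinedEulerian_succ,
      show 2 * m + 2 = 2 * m + 1 + 1 by ring, Finset.sum_range_succ,
      Finset.sum_range_two_mul_add_one, Finset.sum_range_succ _ m]
    have e1 : ∀ k, Even (2 * k + 2) := fun k => ⟨k + 1, by ring⟩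
    have e2 : ∀ k, ¬ Even (2 * k + 1) := fun k => by rw [Nat.not_even_iff_odd]; exact ⟨k, rfl⟩
    simp only [e1, e2, if_true, if_false, Even.zero, Nat.choose_zero_right, Nat.cast_one, one_mul,
      Nat.sub_zero]
    have h0 : refinedEulerian 0 p q = 1 := by simp [refinedEulerian, odes, edes]
    have hs1 : ∀ k ∈ Finset.range m, ((2 * m + 1 + 1).choose (2 * k + 2) : R) *
        (p * (refinedEulerian (2 * k + 2) p q * refinedEulerian (2 * m + 1 + 1 - (2 * k + 2)) q p))
        = ((2 * m + 1 + 1).choose (2 * k + 2) : R) *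
        (p * ((1 + p * q + (p + q)) * (G k p q * G (m - 1 - k) p q))) := by
      intro k hk
      have hk := Finset.mem_range.1 hk
      rw [show 2 * m + 1 + 1 - (2 * k + 2) = 2 * (m - 1 - k) + 2 by omega, hE k (by omega),
        hE _ (by omega), (hG (m - 1 - k) (by omega)).symm q p]
      ring
    have hs2 : ∀ k ∈ Finset.range (m + 1), ((2 * m + 1 + 1).choose (2 * k + 1) : R) *
        (q * (refinedEulerian (2 * k + 1) p q * refinedEulerian (2 * m + 1 + 1 - (2 * k + 1)) p q))
        = ((2 * m + 1 + 1).choose (2 * k + 1) : R) *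
        (q * (refinedEulerian (2 * k + 1) p q * refinedEulerian (2 * (m - k) + 1) p q)) := by
      intro k hk
      have hk := Finset.mem_range.1 hk
      rw [show 2 * m + 1 + 1 - (2 * k + 1) = 2 * (m - k) + 1 by omega]
    have hs3 := Finset.sum_congr rfl hs2
    rw [Finset.sum_range_succ, Finset.sum_range_succ] at hs3
    rw [Finset.sum_congr rfl hs1, h0, show 2 * m + 1 + 1 = 2 * m + 2 by ring] at *
    rw [hE m (by omega), hE m (by omega), (hG m (by omega)).symm q p]
    linear_combination hs3
  -- `key` is not visibly symmetric. Adding its mirror image, which has the same value, turns the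
  -- stray `p` and `q` into $p+q$ and produces twice the polynomial.
  refine IsFormOfDegree.of_two_mul h2 ?_
  have hsymm : ∀ p q : R, 2 * refinedEulerian (2 * (m + 1) + 1) p q =
      ((((2 : ℕ) : R) * (1 + p * q) + ((2 : ℕ) : R) * (p + q)) * G m p q +
      ∑ k ∈ Finset.range m, ((2 * m + 2).choose (2 * k + 2) : R) *
        ((p + q) * ((1 + p * q + (p + q)) * (G k p q * G (m - 1 - k) p q)))) +
      ∑ k ∈ Finset.range (m + 1), ((2 * m + 2).choose (2 * k + 1) : R) *
        ((p + q) * (refinedEulerian (2 * k + 1) p q * refinedEulerian (2 * (m - k) + 1) p q)) := by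
    intro p q
    rw [two_mul]
    nth_rewrite 2 [refinedEulerian_comm_of_odd ⟨m + 1, rfl⟩]
    rw [key p q, key q p]
    have h1 : ∀ k ∈ Finset.range m, ((2 * m + 2).choose (2 * k + 2) : R) *
        (q * ((1 + q * p + (q + p)) * (G k q p * G (m - 1 - k) q p))) =
        ((2 * m + 2).choose (2 * k + 2) : R) *
        (q * ((1 + p * q + (p + q)) * (G k p q * G (m - 1 - k) p q))) := by
      intro k hk
      have hk := Finset.mem_range.1 hk
      rw [(hG k (by omega)).symm q p, (hG (m - 1 - k) (by omega)).symm q p, mul_comm q p,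
        add_comm q p]
    have h3 : ∀ k ∈ Finset.range (m + 1), ((2 * m + 2).choose (2 * k + 1) : R) *
        (p * (refinedEulerian (2 * k + 1) q p * refinedEulerian (2 * (m - k) + 1) q p)) =
        ((2 * m + 2).choose (2 * k + 1) : R) *
        (p * (refinedEulerian (2 * k + 1) p q * refinedEulerian (2 * (m - k) + 1) p q)) := by
      intro k _
      rw [refinedEulerian_comm_of_odd ⟨k, rfl⟩ q p, refinedEulerian_comm_of_odd ⟨m - k, rfl⟩ q p]
    rw [Finset.sum_congr rfl h1, Finset.sum_congr rfl h3, (hG m (by omega)).symm q p]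
    have hsplit : ∀ (s : Finset ℕ) (c X : ℕ → R), ∑ k ∈ s, c k * ((p + q) * X k) =
        ∑ k ∈ s, c k * (p * X k) + ∑ k ∈ s, c k * (q * X k) := by
      intro s c X
      rw [← Finset.sum_add_distrib]
      exact Finset.sum_congr rfl fun k _ => by ring
    rw [hsplit, hsplit]
    push_cast
    ring
  simp only [hsymm]
  refine ((IsFormOfDegree.mul (m := 1) (k := m) ?_ (hG m (by omega)) (by omega)).add ?_).add ?_
  · exact ((IsFormOfDegree.natCast 2).mul .one_add_mul_self rfl).add
      ((IsFormOfDegree.natCast 2).mul .add_self rfl)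
  · refine .sum fun k hk => ?_
    have hk := Finset.mem_range.1 hk
    exact (IsFormOfDegree.natCast _).mul (IsFormOfDegree.add_self.mul
      ((IsFormOfDegree.one_add_mul_self.add .add_self).mul
        ((hG k (by omega)).mul (hG (m - 1 - k) (by omega)) rfl) rfl) rfl) (by omega)
  · refine .sum fun k hk => ?_
    have hk := Finset.mem_range.1 hk
    exact (IsFormOfDegree.natCast _).mul (IsFormOfDegree.add_self.mul
      ((hO k (by omega)).mul (hO (m - k) (by omega)) rfl) rfl) (by omega)

/-- Refined Eulerian polynomials of even index are `1 + p` times forms in `p + q` and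
`1 + p * q`, given the same for smaller indices. -/
lemma isFormOfDegree_refinedEulerian_even_step {m : ℕ} {G : ℕ → R → R → R}
    (hO : ∀ k < m + 1, IsFormOfDegree k (refinedEulerian (R := R) (2 * k + 1)))
    (hG : ∀ k < m, IsFormOfDegree k (G k))
    (hE : ∀ k < m, ∀ p q, refinedEulerian (2 * k + 2) p q = (1 + p) * G k p q) :
    ∃ H : R → R → R, IsFormOfDegree m H ∧
      ∀ p q, refinedEulerian (2 * m + 2) p q = (1 + p) * H p q := by
  -- The terms $j=2k+2$ and $2m+1-j$ have equal binomials and combine to $(1+p)(p+q)$ times a common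
  -- product; $j=0$ and the trailing term give $(1+p)A_{2m+1}$.
  refine ⟨fun p q => refinedEulerian (2 * m + 1) p q +
    ∑ k ∈ Finset.range m, ((2 * m + 1).choose (2 * k + 2) : R) *
      ((p + q) * (G k p q * refinedEulerian (2 * (m - 1 - k) + 1) p q)), ?_, ?_⟩
  · refine (hO m (by omega)).add (.sum fun k hk => ?_)
    have hk := Finset.mem_range.1 hk
    exact (IsFormOfDegree.natCast _).mul (IsFormOfDegree.add_self.mul
      ((hG k (by omega)).mul (hO (m - 1 - k) (by omega)) rfl) rfl) (by omega)
  · intro p q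
    rw [refinedEulerian_succ, Finset.sum_range_two_mul_add_one]
    have e1 : ∀ k, Even (2 * k + 2) := fun k => ⟨k + 1, by ring⟩
    have e2 : ∀ k, ¬ Even (2 * k + 1) := fun k => by rw [Nat.not_even_iff_odd]; exact ⟨k, rfl⟩
    simp only [e1, e2, if_true, if_false, Even.zero, Nat.choose_zero_right, Nat.cast_one, one_mul,
      Nat.sub_zero]
    have h0 : refinedEulerian 0 p q = 1 := by simp [refinedEulerian, odes, edes]
    rw [h0, refinedEulerian_comm_of_odd ⟨m, rfl⟩ q p, add_assoc (p * _),
      ← Finset.sum_range_reflect (fun k => ((2 * m + 1).choose (2 * k + 1) : R) * (q * _)) m,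
      ← Finset.sum_add_distrib]
    have hs : ∀ k ∈ Finset.range m, ((2 * m + 1).choose (2 * k + 2) : R) *
        (p * (refinedEulerian (2 * k + 2) p q * refinedEulerian (2 * m + 1 - (2 * k + 2)) q p)) +
        ((2 * m + 1).choose (2 * (m - 1 - k) + 1) : R) *
        (q * (refinedEulerian (2 * (m - 1 - k) + 1) p q *
          refinedEulerian (2 * m + 1 - (2 * (m - 1 - k) + 1)) p q)) =
        (1 + p) * (((2 * m + 1).choose (2 * k + 2) : R) *
          ((p + q) * (G k p q * refinedEulerian (2 * (m - 1 - k) + 1) p q))) := by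
      intro k hk
      have hk := Finset.mem_range.1 hk
      rw [Nat.choose_symm_of_eq_add (show 2 * m + 1 = 2 * (m - 1 - k) + 1 + (2 * k + 2) by omega),
        show 2 * m + 1 - (2 * k + 2) = 2 * (m - 1 - k) + 1 by omega,
        show 2 * m + 1 - (2 * (m - 1 - k) + 1) = 2 * k + 2 by omega,
        refinedEulerian_comm_of_odd ⟨m - 1 - k, rfl⟩ q p, hE k hk]
      ring
    rw [Finset.sum_congr rfl hs, ← Finset.mul_sum]
    ring

/-- Both parities go through one strong induction: the even index $2m+2$ also needs the odd index
$2m+1$ just below it. -/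
lemma isFormOfDegree_refinedEulerian [NoZeroDivisors R] (h2 : (2 : R) ≠ 0) (m : ℕ) :
    IsFormOfDegree m (refinedEulerian (R := R) (2 * m + 1)) ∧
    ∃ G : R → R → R, IsFormOfDegree m G ∧
      ∀ p q, refinedEulerian (2 * m + 2) p q = (1 + p) * G p q := by
  induction m using Nat.strong_induction_on with
  | _ m ih =>
    choose! hO G hG hE using ih
    have hm : IsFormOfDegree m (refinedEulerian (R := R) (2 * m + 1)) := by
      rcases m with _ | m
      · have h : (refinedEulerian (R := R) (2 * 0 + 1)) = fun _ _ => ((1 : ℕ) : R) := by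
          funext p q
          rw [refinedEulerian_succ]
          simp [refinedEulerian, odes, edes]
        rw [h]
        exact .natCast 1
      · exact isFormOfDegree_refinedEulerian_odd_step h2 hO hG hE
    refine ⟨hm, isFormOfDegree_refinedEulerian_even_step (fun k hk => ?_) hG hE⟩
    rcases Nat.lt_succ_iff_lt_or_eq.1 hk with h | rfl
    · exact hO k h
    · exact hm

/-- The relation between the refined and the classical Eulerian polynomials, with denominators
cleared. -/
lemma refinedEulerian_mul_pow [NoZeroDivisors R] (h2 : (2 : R) ≠ 0) (n : ℕ) {p q x : R}
    (hx : (p + q) * (1 + x ^ 2) = 2 * x * (1 + p * q)) :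
    refinedEulerian (2 * n + 1) p q * (1 + x ^ 2) ^ n =
        eulerian (2 * n + 1) x * (1 + p * q) ^ n ∧
      (1 + q) * refinedEulerian (2 * n + 2) p q * (1 + x ^ 2) ^ (n + 1) =
        (1 + x) * eulerian (2 * n + 2) x * (1 + p * q) ^ (n + 1) := by
  obtain ⟨hO, G, hG, hE⟩ := isFormOfDegree_refinedEulerian h2 n
  have hx' : (p + q) * (1 + x * x) = (x + x) * (1 + p * q) := by
    linear_combination hx
  rw [eulerian_eq_refinedEulerian, eulerian_eq_refinedEulerian, hE, hE, sq]
  refine ⟨hO.scale p q x x hx', ?_⟩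
  -- The extra factors match because $(1+p)(1+q)=(1+pq)+(p+q)$, so `hx'` gives
  -- $(1+p)(1+q)(1+x^2)=(1+x)^2(1+pq)$.
  linear_combination (1 + p) * (1 + q) * (1 + x * x) * hG.scale p q x x hx' +
    G x x * (1 + p * q) ^ n * hx'

end homogeneous

/-! ### The Catalan substitution and the final formulas. -/

/-- Any solution of the Catalan equation parametrizes `(p + q) / (2 * (1 + p * q))`. -/
lemma one_add_sq_eq_of_catalan {R : Type*} [CommRing R] {y c : R} (hc : c = 1 + y ^ 2 * c ^ 2) :
    1 + (y * c) ^ 2 = c := by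
  linear_combination -hc

/-- Only $s^2=1-4u$ is used of the square root $s$; the choice of branch plays no role. -/
lemma catalanC_eq (u : ℂ) : catalanC u = 1 + u * catalanC u ^ 2 := by
  unfold catalanC
  split_ifs with hu
  · simp [hu]
  · have hs : ((1 - 4 * u) ^ (1 / 2 : ℂ)) ^ 2 = 1 - 4 * u := by
      rw [← Complex.cpow_nat_mul]
      simp
    generalize (1 - 4 * u) ^ (1 / 2 : ℂ) = s at hs
    field_simp
    linear_combination -hs

/-- Substituting a series without constant term is a ring homomorphism, so it carries over the
Catalan equation. -/
lemma formalCatalanC_eq {u : MvPowerSeries (Fin 2) ℚ} (hu : MvPowerSeries.constantCoeff u = 0) :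
    formalCatalanC u = 1 + u * formalCatalanC u ^ 2 := by
  have hs := PowerSeries.HasSubst.of_constantCoeff_zero hu
  have h := congrArg (PowerSeries.map (Nat.castRingHom ℚ))
    PowerSeries.catalanSeries_sq_mul_X_add_one
  have h' := congrArg (PowerSeries.substAlgHom hs) h
  simp only [map_add, map_mul, map_pow, map_one, PowerSeries.map_X,
    PowerSeries.substAlgHom_X, PowerSeries.coe_substAlgHom] at h'
  rw [formalCatalanC]
  linear_combination -h'

theorem corollary2p3 :
    -- The formulas for complex numbers `p`, `q`.
    (∀ (n : ℕ) (p q : ℂ), 1 + p * q ≠ 0 →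
      let c : ℂ := catalanC ((p + q) ^ 2 / (4 * (1 + p * q) ^ 2))
      let x : ℂ := (p + q) / (2 * (1 + p * q)) * c
      refinedEulerian (2 * n + 1) p q =
          eulerian (2 * n + 1) x * ((1 + p * q) / c) ^ n ∧
      (1 + q ≠ 0 →
        refinedEulerian (2 * n + 2) p q =
          (1 + x) / (1 + q) * eulerian (2 * n + 2) x * ((1 + p * q) / c) ^ (n + 1))) ∧
    -- The formulas for indeterminates `p`, `q`, in the ring of formal power series `ℚ⟦p, q⟧`.
    (∀ n : ℕ,
      let p : MvPowerSeries (Fin 2) ℚ := MvPowerSeries.X 0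
      let q : MvPowerSeries (Fin 2) ℚ := MvPowerSeries.X 1
      let c : MvPowerSeries (Fin 2) ℚ := formalCatalanC ((p + q) ^ 2 * (4 * (1 + p * q) ^ 2)⁻¹)
      let x : MvPowerSeries (Fin 2) ℚ := (p + q) * (2 * (1 + p * q))⁻¹ * c
      refinedEulerian (2 * n + 1) p q =
          eulerian (2 * n + 1) x * ((1 + p * q) * c⁻¹) ^ n ∧
      refinedEulerian (2 * n + 2) p q =
          (1 + x) * (1 + q)⁻¹ * eulerian (2 * n + 2) x * ((1 + p * q) * c⁻¹) ^ (n + 1)) := by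
  constructor
  · intro n p q hpq c x
    have hy : (p + q) ^ 2 / (4 * (1 + p * q) ^ 2) = ((p + q) / (2 * (1 + p * q))) ^ 2 := by
      rw [div_pow, mul_pow]
      norm_num
    have hc : c = 1 + ((p + q) / (2 * (1 + p * q))) ^ 2 * c ^ 2 := by
      rw [← hy]
      exact catalanC_eq _
    have hc0 : c ≠ 0 := fun h => by simp [h] at hc
    have hxc : 1 + x ^ 2 = c := one_add_sq_eq_of_catalan hc
    have hx : (p + q) * (1 + x ^ 2) = 2 * x * (1 + p * q) := by
      rw [hxc]
      simp only [x]
      field_simp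
    obtain ⟨h1, h2⟩ := refinedEulerian_mul_pow two_ne_zero n hx
    rw [hxc] at h1 h2
    refine ⟨?_, fun hq => ?_⟩
    · rw [div_pow, mul_div_assoc', eq_div_iff (pow_ne_zero _ hc0), h1]
    · rw [div_pow, mul_div_assoc', eq_div_iff (pow_ne_zero _ hc0), div_mul_eq_mul_div,
        div_mul_eq_mul_div, eq_div_iff hq, ← h2]
      ring
  · intro n p q c x
    have hpq : MvPowerSeries.constantCoeff (1 + p * q) = 1 := by simp [p, q]
    have hq : (1 + q)⁻¹ * (1 + q) = 1 := MvPowerSeries.inv_mul_cancel _ (by simp [q])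
    have hd : (2 * (1 + p * q))⁻¹ * (2 * (1 + p * q)) = 1 :=
      MvPowerSeries.inv_mul_cancel _ (by rw [map_mul, hpq, map_ofNat]; simp)
    have hy : (p + q) ^ 2 * (4 * (1 + p * q) ^ 2)⁻¹ = ((p + q) * (2 * (1 + p * q))⁻¹) ^ 2 := by
      have h : (4 * (1 + p * q) ^ 2)⁻¹ = ((2 * (1 + p * q))⁻¹) ^ 2 := by
        rw [MvPowerSeries.inv_eq_iff_mul_eq_one (by rw [map_mul, map_pow, hpq, map_ofNat]; simp)]
        linear_combination ((2 * (1 + p * q))⁻¹ * (2 * (1 + p * q)) + 1) * hd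
      rw [h, mul_pow]
    have hu : MvPowerSeries.constantCoeff ((p + q) ^ 2 * (4 * (1 + p * q) ^ 2)⁻¹) = 0 := by simp [p, q]
    have hc : c = 1 + ((p + q) * (2 * (1 + p * q))⁻¹) ^ 2 * c ^ 2 := by
      rw [← hy]
      exact formalCatalanC_eq hu
    have hc0 : c⁻¹ * c = 1 := by
      refine MvPowerSeries.inv_mul_cancel _ ?_
      rw [hc, ← hy, map_add, map_mul, hu]
      simp
    have hxc : 1 + x ^ 2 = c := one_add_sq_eq_of_catalan hc
    have hx : (p + q) * (1 + x ^ 2) = 2 * x * (1 + p * q) := by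
      rw [hxc]
      simp only [x]
      linear_combination -(p + q) * c * hd
    have htwo : (2 : MvPowerSeries (Fin 2) ℚ) ≠ 0 := fun h => by
      have h' := congrArg MvPowerSeries.constantCoeff h
      rw [map_ofNat, map_zero] at h'
      norm_num at h'
    obtain ⟨h1, h2⟩ := refinedEulerian_mul_pow htwo n hx
    rw [hxc] at h1 h2
    have hcn : ∀ k, c⁻¹ ^ k * c ^ k = 1 := fun k => by rw [← mul_pow, hc0, one_pow]
    constructor
    · rw [mul_pow]
      linear_combination c⁻¹ ^ n * h1 - refinedEulerian (2 * n + 1) p q * hcn n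
    · rw [mul_pow]
      linear_combination (1 + q)⁻¹ * c⁻¹ ^ (n + 1) * h2 -
        (1 + q)⁻¹ * (1 + q) * refinedEulerian (2 * n + 2) p q * hcn (n + 1) -
        refinedEulerian (2 * n + 2) p q * hq
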